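/- Let $\mathbb K$ be a field of characteristic $0$, let $I$ be a finite set, and let $P$ be a set partitioned into (possibly empty) classes $\{P_i\}_{i\in I}$. To each $p\in P$ assign a weight $w_p\in\mathbb Z_{\ge1}$, such that only finitely many $p$ have any given weight, a finite set $E_p$ of insertion places, and for each $e\in E_p$ an insertion exponent vector $\mu_e\in\mathbb K^I$. A $(P,\mathcal E)$-tree is a (finite, nonempty) rooted tree, up to isomorphism, in which each vertex $v$ carries a decoration $d(v)\in P$ and each edge from a parent $v$ to a child carries a decoration in $E_{d(v)}$; a $(P,\mathcal E)$-forest is a finite disjoint union of such trees. Let $\widetilde{\mathcal H}_{P,\mathcal E}$ be the $\mathbb K$-vector space with basis the $(P,\mathcal E)$-forests, with disjoint union as multiplication, and let $\tilde B_+^{(p)}\colon \widetilde{\mathcal H}_{P,\mathcal E}^{\otimes E_p}\to\widetilde{\mathcal H}_{P,\mathcal E}$ be the linear map sending $\bigotimes_{e\in E_p}f_e$ (with $f_e$ forests) to the tree obtained by adding a new root of decoration $p$, joined to the root of each component of $f_e$ by an edge of decoration $e$, for all $e \in E_p$. Consider the system of equations, for $i\in I$, $$T_i(x)=1+\sum_{p\in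 P_i}x^{w_p}\,\tilde B_+^{(p)}\Big(\bigotimes_{e\in E_p}\mathbf T(x)^{\mu_e}\Big)$$ for $\mathbf T(x)=(T_i(x))_{i\in I}\in\widetilde{\mathcal H}_{P,\mathcal E}[[x]]^I$. Here $\mathbf T(x)^{\mu}=\prod_{i\in I}T_i(x)^{\mu_i}$, the powers are given by the binomial series (the equations force each $T_i(x)$ to have constant term $1$), the tensor product of power series is read in $\widetilde{\mathcal H}_{P,\mathcal E}^{\otimes E_p}[[x]]$, and $\tilde B_+^{(p)}$ is applied coefficientwise. For a vertex $v$ of a tree $t$ and $e\in E_{d(v)}$ let $\mathbf{od}(v,e)\in\mathbb Z_{\ge0}^I$ be the vector whose $i$-th entry is the number of children of $v$ that have their decoration in $P_i$ and are joined to $v$ by an edge of decoration $e$. Write $\mu^{\underline{\mathbf k}}=\prod_{i\in I}\prod_{j=0}^{k_i-1}(\mu_i-j)$ for $\mu \in \mathbb K^I$ and $\mathbf k \in \mathbb Z_{\ge 0}^I$, $w(t)=\sum_{v\in t}w_{d(v)}$, and let $\mathrm{Aut}(t)$ be the group of automorphisms of $t$ preserving all decorations. Then for each $n$ there are only finitely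 many $(P,\mathcal E)$-trees with $w(t)=n$, and the system has exactly one solution, namely $$T_i(x)=1+\sum_{t}\Big(\prod_{v\in t}\prod_{e\in E_{d(v)}}\mu_e^{\underline{\mathbf{od}(v,e)}}\Big)\frac{t\,x^{w(t)}}{|\mathrm{Aut}(t)|},$$ where $t$ runs over all $(P,\mathcal E)$-trees whose root has its decoration in $P_i$. -/

import Mathlib

universe u v w

namespace DSE

open scoped TensorProduct

section Trees

/-- Finite rooted trees in which every vertex carries a decoration in `P` and every edge below a
vertex of decoration `p` carries a decoration in `E p`, presented with an auxiliary ordering of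
the children of each vertex: a root of decoration `p`, with `k` child subtrees, the `j`-th of them
attached by an edge of decoration `lab j`.  The ordering is forgotten in `Tree` below. -/
inductive OrdTree (P : Type u) (E : P → Type v) : Type (max u v)
  | node (p : P) (k : ℕ) (lab : Fin k → E p) (child : Fin k → OrdTree P E) : OrdTree P E

variable {P : Type u} {E : P → Type v}

namespace OrdTree

/-- The vertices of a tree: the root `none`, and the vertices of the child subtrees. -/
def Vert : OrdTree P E → Type
  | node _ k _ child => Option (Σ j : Fin k, Vert (child j))

/-- The set of vertices is finite. -/
noncomputable instance instFintypeVert : (t : OrdTree P E) → Fintype (Vert t)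
  | node _ k _ child =>
    haveI : ∀ j : Fin k, Fintype (Vert (child j)) := fun j => instFintypeVert (child j)
    inferInstanceAs (Fintype (Option (Σ j : Fin k, Vert (child j))))

/-- The root vertex. -/
def root : (t : OrdTree P E) → Vert t
  | node _ _ _ _ => none

/-- The decoration `d(v)` of a vertex `v`. -/
def dec : (t : OrdTree P E) → Vert t → P
  | node p _ _ _, none => p
  | node _ _ _ child, some ⟨j, v⟩ => dec (child j) v

/-- `Edge t a ⟨p, e⟩ b` says that `b` is a child of `a`, that `p` is the decoration of `a`, and
that the edge from `a` to `b` has the decoration `e ∈ E p`. -/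
def Edge : (t : OrdTree P E) → Vert t → (Σ p : P, E p) → Vert t → Prop
  | node _ _ _ _, _, _, none => False
  | node p _ lab child, none, l, some ⟨j, b⟩ => l = ⟨p, lab j⟩ ∧ b = root (child j)
  | node _ _ _ child, some ⟨i, a⟩, l, some ⟨j, b⟩ =>
      ∃ h : i = j, Edge (child j) (h ▸ a) l b

/-- Isomorphisms of decorated rooted trees: bijections between the vertices that preserve the
root, the parent-child relation, the decorations of the vertices and those of the edges. -/
structure Iso (s t : OrdTree P E) where
  toEquiv : Vert s ≃ Vert t
  map_root : toEquiv (root s) = root t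
  map_dec : ∀ a, dec t (toEquiv a) = dec s a
  map_edge : ∀ a l b, Edge t (toEquiv a) l (toEquiv b) ↔ Edge s a l b

/-- The identity isomorphism. -/
def Iso.refl (t : OrdTree P E) : Iso t t :=
  ⟨Equiv.refl _, rfl, fun _ => rfl, fun _ _ _ => Iff.rfl⟩

/-- The inverse of an isomorphism. -/
def Iso.symm {s t : OrdTree P E} (f : Iso s t) : Iso t s where
  toEquiv := f.toEquiv.symm
  map_root := by rw [← f.map_root, Equiv.symm_apply_apply]
  map_dec a := by rw [← f.map_dec, Equiv.apply_symm_apply]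
  map_edge a l b := by rw [← f.map_edge, Equiv.apply_symm_apply, Equiv.apply_symm_apply]

/-- The composite of two isomorphisms. -/
def Iso.trans {r s t : OrdTree P E} (f : Iso r s) (g : Iso s t) : Iso r t where
  toEquiv := f.toEquiv.trans g.toEquiv
  map_root := by rw [Equiv.trans_apply, f.map_root, g.map_root]
  map_dec a := by rw [Equiv.trans_apply, g.map_dec, f.map_dec]
  map_edge a l b := by
    rw [Equiv.trans_apply, Equiv.trans_apply, g.map_edge, f.map_edge]

/-- Two trees are identified when they are isomorphic. -/
instance instSetoid (P : Type u) (E : P → Type v) : Setoid (OrdTree P E) where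
  r s t := Nonempty (Iso s t)
  iseqv := ⟨fun t => ⟨Iso.refl t⟩, fun ⟨f⟩ => ⟨f.symm⟩, fun ⟨f⟩ ⟨g⟩ => ⟨f.trans g⟩⟩

/-- The order `|Aut(t)|` of the automorphism group. -/
noncomputable def autCard (t : OrdTree P E) : ℕ := Nat.card (Iso t t)

/-- The total weight `w(t) = ∑_{v ∈ t} w_{d(v)}`. -/
noncomputable def weight (wt : P → ℕ) (t : OrdTree P E) : ℕ := ∑ a : Vert t, wt (dec t a)

/-- `od_i(a, e)`, for an insertion place `e ∈ E p`: the number of children of `a` that have their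
decoration in `P_i = {p | part p = i}` and are joined to `a` by an edge of decoration `e`. -/
noncomputable def outdeg {I : Type w} (part : P → I) (t : OrdTree P E) (a : Vert t) {p : P}
    (e : E p) (i : I) : ℕ :=
  Nat.card {b : Vert t // Edge t a ⟨p, e⟩ b ∧ part (dec t b) = i}

end OrdTree

/-- The falling factorial power `a (a - 1) ⋯ (a - k + 1)`. -/
def fallingPow {K : Type*} [Field K] (a : K) (k : ℕ) : K := ∏ j ∈ Finset.range k, (a - (j : K))

/-- The product over all vertices `a` of the tree, all insertion places `e ∈ E_{d(a)}` and all
`i ∈ I` of the falling factorial power of `μ_{e,i}` with exponent `od_i(a, e)`. -/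
noncomputable def OrdTree.coefficient {K : Type*} [Field K] {I : Type w} [Fintype I]
    [∀ p, Fintype (E p)] (part : P → I) (μ : ∀ p, E p → I → K) (t : OrdTree P E) : K :=
  ∏ a : Vert t, ∏ e : E (dec t a), ∏ i : I,
    fallingPow (μ (dec t a) e i) (outdeg part t a e i)

namespace OrdTree

theorem autCard_congr {s t : OrdTree P E} (f : Iso s t) : autCard s = autCard t := by
  refine Nat.card_congr
    ⟨fun g => (f.symm.trans g).trans f, fun g => (f.trans g).trans f.symm, fun g => ?_, fun g => ?_⟩
  · cases g
    simp [Iso.trans, Iso.symm, Equiv.ext_iff]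
  · cases g
    simp [Iso.trans, Iso.symm, Equiv.ext_iff]

theorem weight_congr (wt : P → ℕ) {s t : OrdTree P E} (f : Iso s t) :
    weight wt s = weight wt t :=
  Fintype.sum_equiv f.toEquiv _ _ fun a => by rw [f.map_dec]

theorem outdeg_congr {I : Type w} (part : P → I) {s t : OrdTree P E} (f : Iso s t) (a : Vert s)
    {p : P} (e : E p) (i : I) :
    outdeg part s a e i = outdeg part t (f.toEquiv a) e i :=
  Nat.card_congr (f.toEquiv.subtypeEquiv fun b => by rw [f.map_edge, f.map_dec])

theorem coefficient_congr {K : Type*} [Field K] {I : Type w} [Fintype I] [∀ p, Fintype (E p)]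
    (part : P → I) (μ : ∀ p, E p → I → K) {s t : OrdTree P E} (f : Iso s t) :
    coefficient part μ s = coefficient part μ t := by
  refine Fintype.prod_equiv f.toEquiv _ _ fun a => ?_
  simp only [outdeg_congr part f]
  rw [f.map_dec]

end OrdTree

variable (P E) in
/-- The set of `(P, E)`-trees: isomorphism classes of decorated finite rooted trees. -/
abbrev Tree : Type (max u v) := Quotient (OrdTree.instSetoid P E)

namespace Tree

/-- The decoration of the root. -/
def rootDec : Tree P E → P :=
  Quotient.lift (fun t => t.dec t.root) fun s t ⟨f⟩ => by
    rw [← f.map_dec, f.map_root]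

/-- The order `|Aut(t)|` of the automorphism group. -/
noncomputable def autCard : Tree P E → ℕ :=
  Quotient.lift OrdTree.autCard fun _ _ ⟨f⟩ => OrdTree.autCard_congr f

/-- The total weight `w(t)`. -/
noncomputable def weight (wt : P → ℕ) : Tree P E → ℕ :=
  Quotient.lift (OrdTree.weight wt) fun _ _ ⟨f⟩ => OrdTree.weight_congr wt f

/-- The product over all vertices and insertion places of the falling factorial powers of the
insertion exponent vectors. -/
noncomputable def coefficient {K : Type*} [Field K] {I : Type w} [Fintype I]
    [∀ p, Fintype (E p)] (part : P → I) (μ : ∀ p, E p → I → K) : Tree P E → K :=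
  Quotient.lift (OrdTree.coefficient part μ) fun _ _ ⟨f⟩ => OrdTree.coefficient_congr part μ f

end Tree

variable (P E) in
/-- The set of `(P, E)`-forests.  A forest is uniquely a disjoint union of trees, so isomorphism
classes of forests are finite multisets of isomorphism classes of trees; disjoint union is `+`. -/
abbrev Forest : Type (max u v) := Multiset (Tree P E)

/-- The tree obtained from a family of forests `F e`, `e ∈ E p`, by adding a new root of
decoration `p` with an edge to the root of each component, where the edges to the components of
`F e` have the decoration `e`.  The components are listed in some order, and a representative of
each is taken; the isomorphism class of the result does not depend on these choices. -/
noncomputable def graft (p : P) [Fintype (E p)] (F : E p → Forest P E) : Tree P E :=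
  let L : List (E p × Tree P E) := (∑ e : E p, (F e).map fun t => (e, t)).toList
  Quotient.mk _ (OrdTree.node p L.length (fun j => (L.get j).1) fun j => (L.get j).2.out)

end Trees

section Algebra

variable (K : Type*) [Field K] {P : Type u} {E : P → Type v}

variable (P E) in
/-- The algebra of `(P, E)`-trees: the free vector space on the `(P, E)`-forests, with the
multiplication given on forests by disjoint union. -/
abbrev TreeAlgebra := AddMonoidAlgebra K (Forest P E)

/-- A tree as an element of the algebra. -/
noncomputable def Tree.toAlgebra (t : Tree P E) : TreeAlgebra K P E := AddMonoidAlgebra.single {t} 1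

/-- The linear operator `B₊^{(p)}` from the tensor power indexed by `E p` of the tree algebra to
the tree algebra that sends a pure tensor of forests to the tree obtained by grafting them to a
new root of decoration `p`. -/
noncomputable def Bplus (p : P) [Fintype (E p)] :
    (⨂[K] _ : E p, TreeAlgebra K P E) →ₗ[K] TreeAlgebra K P E :=
  (Basis.piTensorProduct fun _ : E p => AddMonoidAlgebra.basis (Forest P E) K).constr K
    fun F : E p → Forest P E => (graft p F).toAlgebra K

variable {K}

/-- The power `S ^ a = ∑_k (a choose k) (S - 1)^k` of a power series `S` with constant term `1`,
for an exponent `a` in the field.  The terms with `k > n` do not contribute to the coefficient of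
`x ^ n`.  (For other constant terms this is a junk value.) -/
noncomputable def seriesPow {A : Type*} [CommRing A] [Algebra K A] (S : PowerSeries A) (a : K) :
    PowerSeries A :=
  PowerSeries.mk fun n =>
    ∑ k ∈ Finset.range (n + 1), (fallingPow a k / (k.factorial : K)) •
      PowerSeries.coeff n ((S - 1) ^ k)

/-- The vector power `𝐓 ^ μ = ∏_i T_i ^ {μ_i}`. -/
noncomputable def vectorPow {A : Type*} [CommRing A] [Algebra K A] {I : Type w} [Fintype I]
    (T : I → PowerSeries A) (m : I → K) : PowerSeries A :=
  ∏ i : I, seriesPow (T i) (m i)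

open scoped Classical in
/-- The coefficient of `x ^ n` in the tensor product `⨂_{e} S_e` of a finite family of power
series over `A`, where a tensor product of power series is read as a power series with
coefficients in the tensor power of `A`. -/
noncomputable def tensorCoeff {A : Type*} [CommRing A] [Algebra K A] {J : Type*} [Fintype J]
    (S : J → PowerSeries A) (n : ℕ) : ⨂[K] _ : J, A :=
  ∑ a ∈ Finset.piAntidiag (Finset.univ : Finset J) n,
    PiTensorProduct.tprod K fun e => PowerSeries.coeff (a e) (S e)

variable {I : Type w} [Fintype I] [∀ p, Fintype (E p)]

/-- The series `B₊^{(p)}(⨂_{e ∈ E_p} 𝐓(x)^{μ_e})`, the operator being applied coefficientwise. -/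
noncomputable def insertionSeries (μ : ∀ p, E p → I → K)
    (T : I → PowerSeries (TreeAlgebra K P E)) (p : P) : PowerSeries (TreeAlgebra K P E) :=
  PowerSeries.mk fun n => Bplus K p (tensorCoeff (fun e : E p => vectorPow T (μ p e)) n)

/-- `T` solves the combinatorial Dyson–Schwinger system: for all `i`,
`T_i(x) = 1 + ∑_{p ∈ P_i} x^{w_p} B₊^{(p)}(⨂_{e ∈ E_p} 𝐓(x)^{μ_e})`, with `P_i = {p | part p = i}`.
The sum is taken coefficientwise; if the weights are positive and each weight is taken finitely
often, then for each `n` only finitely many `p` contribute to the coefficient of `x ^ n`. -/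
def IsSolution (part : P → I) (wt : P → ℕ) (μ : ∀ p, E p → I → K)
    (T : I → PowerSeries (TreeAlgebra K P E)) : Prop :=
  ∀ i, T i = 1 + PowerSeries.mk fun n =>
    ∑ᶠ p ∈ {p : P | part p = i},
      PowerSeries.coeff n
        ((PowerSeries.X : PowerSeries (TreeAlgebra K P E)) ^ wt p * insertionSeries μ T p)

/-- The series `1 + ∑_t (∏_v ∏_{e ∈ E_{d(v)}} μ_e^{\underline{od(v,e)}}) t x^{w(t)} / |Aut(t)|`,
over the trees `t` whose root has its decoration in `P_i`. -/
noncomputable def treeSeries (part : P → I) (wt : P → ℕ) (μ : ∀ p, E p → I → K) (i : I) :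
    PowerSeries (TreeAlgebra K P E) :=
  1 + PowerSeries.mk fun n =>
    ∑ᶠ t ∈ {t : Tree P E | part t.rootDec = i ∧ t.weight wt = n},
      (t.coefficient part μ / (t.autCard : K)) • t.toAlgebra K

end Algebra

end DSE

/-! A tree is the same thing as a root decoration `p` together with a family of forests indexed by
`E p`: cutting off the root inverts `graft` (`graft_injective`, `exists_eq_graft`). Write `c t` for
the coefficient of `t` divided by `|Aut t|` (`treeCoeff`).

For existence, let `T_i - 1` be the sum of `c t · t` over trees of class `i`. The multinomial
theorem followed by the binomial series expands `𝐓 ^ μ` over forests `F`, with coefficient the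
falling powers of the `μ_i` at the numbers of components of class `i`, times the product of `c` over
the components, divided by the factorials of their multiplicities
(`coeff_vectorPow_eq_sum_forests`). The numerator and the automorphism count of a grafted tree
factor in just this way (`coefficient_graft`, `autCard_graft`), so the product over `e` of these
coefficients is `c (graft p F)` (`treeCoeff_graft`). Applying `Bplus` and summing over `p` therefore
runs through every tree exactly once.

For uniqueness, the factor `x ^ wt p` with `wt p ≥ 1` makes the coefficient of `x ^ n` on the right
depend only on lower coefficients of `T`. -/

namespace DSE

/-! ### Isomorphisms and automorphisms of trees, in terms of the branches at the root -/

section Combinatorics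

variable {P : Type u} {E : P → Type v}

-- The multiplicity of a value is the size of its fibre, so corresponding fibres are equinumerous
-- and bijections between them glue.
open scoped Classical in
theorem exists_perm_of_map_univ_eq {α β : Type*} [Fintype α] {f g : α → β}
    (h : Finset.univ.val.map f = Finset.univ.val.map g) :
    ∃ σ : Equiv.Perm α, g ∘ σ = f := by
  have hc : ∀ x, Nonempty ({a // f a = x} ≃ {a // g a = x}) := by
    intro x
    rw [← Fintype.card_eq, Fintype.card_subtype, Fintype.card_subtype]
    have := congrArg (Multiset.count x) h
    simp only [Multiset.count_map] at this
    simp only [eq_comm (a := x)] at this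
    exact this
  let e := fun x => (hc x).some
  refine ⟨(Equiv.sigmaFiberEquiv f).symm.trans
    ((Equiv.sigmaCongrRight e).trans (Equiv.sigmaFiberEquiv g)), ?_⟩
  funext a
  exact (e (f a) ⟨a, rfl⟩).2

namespace OrdTree

theorem Iso.ext {s t : OrdTree P E} {f g : Iso s t} (h : ∀ a, f.toEquiv a = g.toEquiv a) :
    f = g := by
  cases f; cases g
  simp only [mk.injEq]
  exact Equiv.ext h

instance instFiniteIso (s t : OrdTree P E) : Finite (Iso s t) :=
  Finite.of_injective Iso.toEquiv fun _ _ h => Iso.ext fun a => by rw [h]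

/-- Composition with `f` and its inverse identifies isomorphisms with automorphisms. -/
theorem card_iso_eq_autCard {s t : OrdTree P E} (f : Iso s t) :
    Nat.card (Iso s t) = autCard s := by
  refine Nat.card_congr ⟨fun g => g.trans f.symm, fun g => g.trans f, fun g => ?_, fun g => ?_⟩
  · exact Iso.ext fun a => by simp [Iso.trans, Iso.symm]
  · exact Iso.ext fun a => by simp [Iso.trans, Iso.symm]

/-- Every vertex is reached from the root along edges. -/
theorem vert_induction : (t : OrdTree P E) → (Q : Vert t → Prop) → Q (root t) →
    (∀ a l b, Edge t a l b → Q a → Q b) → ∀ a, Q a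
  | node _ _ _ _, _, h0, _, none => h0
  | node p _ lab child, Q, h0, h1, some ⟨j, v⟩ =>
      vert_induction (child j) (fun v => Q (some ⟨j, v⟩))
        (h1 none ⟨p, lab j⟩ (some ⟨j, root (child j)⟩) ⟨rfl, rfl⟩ h0)
        (fun a l b hab => h1 (some ⟨j, a⟩) l (some ⟨j, b⟩) ⟨rfl, hab⟩) v

section Node

variable {p : P} {k k' : ℕ} {lab : Fin k → E p} {child : Fin k → OrdTree P E}
  {lab' : Fin k' → E p} {child' : Fin k' → OrdTree P E}

/-- The isomorphism of trees assembled from a bijection between the child subtrees of the roots,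
and isomorphisms between corresponding child subtrees. -/
def Iso.node (σ : Fin k ≃ Fin k') (hl : ∀ j, lab' (σ j) = lab j)
    (g : ∀ j, Iso (child j) (child' (σ j))) :
    Iso (OrdTree.node p k lab child) (OrdTree.node p k' lab' child') where
  toEquiv := Equiv.optionCongr (Equiv.sigmaCongr σ fun j => (g j).toEquiv)
  map_root := rfl
  map_dec
    | none => rfl
    | some ⟨j, v⟩ => (g j).map_dec v
  map_edge
    | _, _, none => Iff.rfl
    | none, l, some ⟨j, b⟩ => by
        change (l = ⟨p, lab' (σ j)⟩ ∧ (g j).toEquiv b = root (child' (σ j))) ↔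
          (l = ⟨p, lab j⟩ ∧ b = root (child j))
        rw [hl, ← (g j).map_root, (g j).toEquiv.apply_eq_iff_eq]
    | some ⟨i, a⟩, l, some ⟨j, b⟩ => by
        change (∃ h : σ i = σ j, Edge (child' (σ j)) (h ▸ (g i).toEquiv a) l ((g j).toEquiv b)) ↔
          ∃ h : i = j, Edge (child j) (h ▸ a) l b
        constructor
        · rintro ⟨h, hE⟩
          obtain rfl := σ.injective h
          exact ⟨rfl, ((g i).map_edge a l b).1 hE⟩
        · rintro ⟨rfl, hE⟩
          exact ⟨rfl, ((g i).map_edge a l b).2 hE⟩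

/-- The root is fixed, so an edge leaving it goes to an edge leaving the root with the same label,
and such edges end at the roots of branches. -/
theorem Iso.exists_child (f : Iso (OrdTree.node p k lab child) (OrdTree.node p k' lab' child'))
    (j : Fin k) : ∃ j', lab' j' = lab j ∧
      f.toEquiv (some ⟨j, root (child j)⟩) = some ⟨j', root (child' j')⟩ := by
  have h : Edge (OrdTree.node p k lab child) none ⟨p, lab j⟩ (some ⟨j, root (child j)⟩) :=
    ⟨rfl, rfl⟩
  replace h := (f.map_edge _ _ _).2 h
  have hr : f.toEquiv none = none := f.map_root
  rw [hr] at h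
  match hb : f.toEquiv (some ⟨j, root (child j)⟩) with
  | none => rw [hb] at h; exact h.elim
  | some ⟨j', b⟩ =>
    rw [hb] at h
    obtain ⟨h1, h2⟩ := h
    refine ⟨j', ?_, by rw [h2]⟩
    have := (Sigma.mk.inj_iff.1 h1).2
    exact (eq_of_heq this).symm

/-- An edge that starts inside a branch stays in it, so the image of the branch root decides where
the whole branch goes. -/
theorem Iso.exists_eq_some (f : Iso (OrdTree.node p k lab child) (OrdTree.node p k' lab' child'))
    (j : Fin k) (j' : Fin k')
    (h : f.toEquiv (some ⟨j, root (child j)⟩) = some ⟨j', root (child' j')⟩)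
    (v : Vert (child j)) : ∃ v', f.toEquiv (some ⟨j, v⟩) = some ⟨j', v'⟩ := by
  refine vert_induction (child j) (fun v => ∃ v', f.toEquiv (some ⟨j, v⟩) = some ⟨j', v'⟩)
    ⟨_, h⟩ ?_ v
  rintro a l b hab ⟨a', ha'⟩
  have hE : Edge (OrdTree.node p k lab child) (some ⟨j, a⟩) l (some ⟨j, b⟩) := ⟨rfl, hab⟩
  replace hE := (f.map_edge _ _ _).2 hE
  rw [ha'] at hE
  match hb : f.toEquiv (some ⟨j, b⟩) with
  | none => rw [hb] at hE; exact hE.elim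
  | some ⟨i, b'⟩ =>
    rw [hb] at hE
    obtain ⟨rfl, -⟩ := hE
    exact ⟨b', rfl⟩

/-- Converse to `Iso.node`; with `Iso.node_injective` it parametrizes all isomorphisms by a matching
of branches and isomorphisms between matched branches. -/
theorem Iso.exists_eq_node
    (f : Iso (OrdTree.node p k lab child) (OrdTree.node p k' lab' child')) :
    ∃ (σ : Fin k ≃ Fin k') (hl : ∀ j, lab' (σ j) = lab j)
      (g : ∀ j, Iso (child j) (child' (σ j))), f = Iso.node σ hl g := by
  -- The matching of branches is read off from `f`, and its inverse from `f.symm`.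
  choose s hs hs' using f.exists_child
  choose s' _ hs₂ using f.symm.exists_child
  have hleft : Function.LeftInverse s' s := by
    intro j
    have h1 := hs₂ (s j)
    rw [← hs' j] at h1
    have h2 : f.symm.toEquiv (f.toEquiv (some ⟨j, root (child j)⟩)) =
      some ⟨j, root (child j)⟩ := f.toEquiv.symm_apply_apply _
    rw [h2] at h1
    have := Option.some.inj h1
    exact (congrArg Sigma.fst this).symm
  have hright : Function.RightInverse s' s := by
    intro j
    have h1 := hs' (s' j)
    rw [← hs₂ j] at h1
    have h2 : f.toEquiv (f.symm.toEquiv (some ⟨j, root (child' j)⟩)) =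
      some ⟨j, root (child' j)⟩ := f.toEquiv.apply_symm_apply _
    rw [h2] at h1
    have := Option.some.inj h1
    exact (congrArg Sigma.fst this).symm
  let σ : Fin k ≃ Fin k' := ⟨s, s', hleft, hright⟩
  choose g hg using fun j => f.exists_eq_some j (s j) (hs' j)
  have hbij : ∀ j, Function.Bijective (g j) := by
    intro j
    constructor
    · intro a b hab
      have : f.toEquiv (some ⟨j, a⟩) = f.toEquiv (some ⟨j, b⟩) := by rw [hg, hg, hab]
      have := Option.some.inj (f.toEquiv.injective this)
      exact eq_of_heq (Sigma.mk.inj_iff.1 this).2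
    · intro b
      have hb : f.symm.toEquiv (some ⟨s j, root (child' (s j))⟩) =
          some ⟨j, root (child j)⟩ := by
        rw [← hs' j]; exact f.toEquiv.symm_apply_apply _
      obtain ⟨a, ha⟩ := f.symm.exists_eq_some (s j) j hb b
      refine ⟨a, ?_⟩
      have h1 : f.toEquiv (some ⟨j, a⟩) = some ⟨s j, b⟩ := by
        rw [← ha]; exact f.toEquiv.apply_symm_apply _
      rw [hg] at h1
      exact eq_of_heq (Sigma.mk.inj_iff.1 (Option.some.inj h1)).2
  refine ⟨σ, hs, fun j => ⟨Equiv.ofBijective (g j) (hbij j), ?_, ?_, ?_⟩, ?_⟩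
  · have h1 := hs' j
    rw [hg] at h1
    exact eq_of_heq (Sigma.mk.inj_iff.1 (Option.some.inj h1)).2
  · intro a
    have h1 := f.map_dec (some ⟨j, a⟩)
    rw [hg] at h1
    exact h1
  · intro a l b
    have h1 := f.map_edge (some ⟨j, a⟩) l (some ⟨j, b⟩)
    rw [hg, hg] at h1
    constructor
    · intro h
      obtain ⟨_, h2⟩ := h1.1 ⟨rfl, h⟩
      exact h2
    · intro h
      obtain ⟨_, h2⟩ := h1.2 ⟨rfl, h⟩
      exact h2
  · refine Iso.ext fun a => ?_
    match a with
    | none => exact f.map_root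
    | some ⟨j, v⟩ => exact hg j v

/-- Values at branch roots recover `σ`, the remaining values recover `g`. The type of `g` depends on
`σ`, hence `HEq`. -/
theorem Iso.node_injective {σ τ : Fin k ≃ Fin k'} {hl : ∀ j, lab' (σ j) = lab j}
    {hl' : ∀ j, lab' (τ j) = lab j} {g : ∀ j, Iso (child j) (child' (σ j))}
    {g' : ∀ j, Iso (child j) (child' (τ j))} (h : Iso.node σ hl g = Iso.node τ hl' g') :
    σ = τ ∧ HEq g g' := by
  have key : ∀ j v, (some ⟨σ j, (g j).toEquiv v⟩ : Option (Σ j, Vert (child' j))) =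
      some ⟨τ j, (g' j).toEquiv v⟩ := fun j v =>
    congrArg (fun f : Iso (OrdTree.node p k lab child) (OrdTree.node p k' lab' child') =>
      f.toEquiv (some ⟨j, v⟩)) h
  obtain rfl : σ = τ := Equiv.ext fun j =>
    congrArg Sigma.fst (Option.some.inj (key j (root (child j))))
  refine ⟨rfl, heq_of_eq (funext fun j => Iso.ext fun v => ?_)⟩
  exact eq_of_heq (Sigma.mk.inj_iff.1 (Option.some.inj (key j v))).2

end Node

/-- The children of the root, each with the decoration of the edge that leads to it. -/
def branches {p : P} {k : ℕ} (lab : Fin k → E p) (child : Fin k → OrdTree P E) (j : Fin k) :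
    E p × Tree P E :=
  (lab j, Quotient.mk _ (child j))

-- An automorphism is a permutation of the root's children preserving edge label and isomorphism
-- class, plus an isomorphism from each child to its image. Every admissible permutation leaves `∏
-- j, autCard (child j)` choices, since matched children are isomorphic.
open scoped Classical in
theorem autCard_node {p : P} {k : ℕ} (lab : Fin k → E p) (child : Fin k → OrdTree P E) :
    autCard (node p k lab child) =
      (∏ x ∈ Finset.univ.image (branches lab child),
        (Fintype.card {j // branches lab child j = x}).factorial) *
      ∏ j, autCard (child j) := by
  -- The product of factorials counts the permutations that preserve `branches`.
  rw [← DomMulAct.stabilizer_card']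
  have hσ : ∀ σ : {σ : Equiv.Perm (Fin k) // branches lab child ∘ σ = branches lab child}, ∀ j,
      lab (σ.1 j) = lab j ∧ Nonempty (Iso (child j) (child (σ.1 j))) := fun σ j =>
    ⟨congrArg Prod.fst (congrFun σ.2 j),
      Quotient.exact (congrArg Prod.snd (congrFun σ.2 j)).symm⟩
  have e : Nat.card (Σ σ : {σ : Equiv.Perm (Fin k) // branches lab child ∘ σ = branches lab child},
      ∀ j, Iso (child j) (child (σ.1 j))) = autCard (node p k lab child) := by
    refine Nat.card_congr (Equiv.ofBijective
      (fun x => Iso.node x.1.1 (fun j => (hσ x.1 j).1) x.2) ⟨?_, ?_⟩)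
    · rintro ⟨⟨σ, h⟩, g⟩ ⟨⟨τ, h'⟩, g'⟩ hgg
      obtain ⟨h1, h2⟩ := Iso.node_injective hgg
      cases h1
      cases h2
      rfl
    · intro f
      obtain ⟨σ, hl, g, rfl⟩ := f.exists_eq_node
      refine ⟨⟨⟨σ, ?_⟩, g⟩, rfl⟩
      funext j
      exact Prod.ext (hl j) (Quotient.sound ⟨(g j).symm⟩)
  rw [← e, Nat.card_sigma]
  rw [Finset.sum_congr rfl (g := fun _ => ∏ j, autCard (child j))]
  · rw [Finset.sum_const, Finset.card_univ, smul_eq_mul]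
  · intro σ _
    rw [Nat.card_pi]
    exact Finset.prod_congr rfl fun j _ => card_iso_eq_autCard (hσ σ j).2.some

/-- The multiset of branches is thus a complete invariant once the root decoration is fixed; this
makes `graft` independent of its choices. -/
theorem node_equiv_iff {p : P} {k k' : ℕ} {lab : Fin k → E p} {child : Fin k → OrdTree P E}
    {lab' : Fin k' → E p} {child' : Fin k' → OrdTree P E} :
    (Quotient.mk _ (node p k lab child) : Tree P E) = Quotient.mk _ (node p k' lab' child') ↔
      Finset.univ.val.map (branches lab child) = Finset.univ.val.map (branches lab' child') := by
  constructor
  · intro h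
    obtain ⟨f⟩ : Nonempty (Iso _ _) := Quotient.exact h
    obtain ⟨σ, hl, g, -⟩ := f.exists_eq_node
    have h1 : branches lab child = branches lab' child' ∘ σ := by
      funext j
      exact Prod.ext (hl j).symm (Quotient.sound ⟨g j⟩)
    rw [h1, ← Multiset.map_map]
    congr 1
    have := congrArg Finset.val (Finset.map_univ_equiv σ)
    rwa [Finset.map_val] at this
  · intro h
    have hk : k = k' := by simpa using congrArg Multiset.card h
    subst hk
    obtain ⟨σ, hσ⟩ := exists_perm_of_map_univ_eq h
    refine Quotient.sound ⟨Iso.node σ (fun j => congrArg Prod.fst (congrFun hσ j)) fun j => ?_⟩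
    exact Nonempty.some (Quotient.exact (congrArg Prod.snd (congrFun hσ j)).symm)

theorem weight_node (wt : P → ℕ) {p : P} {k : ℕ} (lab : Fin k → E p)
    (child : Fin k → OrdTree P E) :
    weight wt (node p k lab child) = wt p + ∑ j, weight wt (child j) := by
  have : weight wt (node p k lab child) =
    ∑ a : Option (Σ j : Fin k, Vert (child j)), wt (dec (node p k lab child) a) := rfl
  rw [this, Fintype.sum_option, Fintype.sum_sigma]
  rfl

section Outdeg
variable {I : Type w} (part : P → I) {p : P} {k : ℕ} (lab : Fin k → E p)
  (child : Fin k → OrdTree P E)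

theorem outdeg_node_none (e : E p) (i : I) :
    outdeg part (node p k lab child) none e i =
      Nat.card {j : Fin k // lab j = e ∧ part (dec (child j) (root (child j))) = i} := by
  symm
  refine Nat.card_congr (Equiv.ofBijective (fun j => ⟨some ⟨j.1, root (child j.1)⟩,
    ⟨by rw [j.2.1], rfl⟩, j.2.2⟩) ⟨?_, ?_⟩)
  · rintro ⟨i, hi⟩ ⟨j, hj⟩ h
    have := Option.some.inj (congrArg Subtype.val h)
    exact Subtype.ext (congrArg Sigma.fst this)
  · rintro ⟨b, hb, hbi⟩
    match b, hb, hbi with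
    | some ⟨j, b⟩, hb, hbi =>
      obtain ⟨h1, rfl⟩ := hb
      exact ⟨⟨j, (eq_of_heq (Sigma.mk.inj_iff.1 h1).2).symm, hbi⟩, rfl⟩

theorem outdeg_node_some (j : Fin k) (a : Vert (child j)) {q : P} (e : E q) (i : I) :
    outdeg part (node p k lab child) (some ⟨j, a⟩) e i = outdeg part (child j) a e i := by
  symm
  refine Nat.card_congr (Equiv.ofBijective (fun b => ⟨some ⟨j, b.1⟩,
    ⟨rfl, b.2.1⟩, b.2.2⟩) ⟨?_, ?_⟩)
  · rintro ⟨b, hb⟩ ⟨c, hc⟩ h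
    have := Option.some.inj (congrArg Subtype.val h)
    exact Subtype.ext (eq_of_heq (Sigma.mk.inj_iff.1 this).2)
  · rintro ⟨b, hb, hbi⟩
    match b, hb, hbi with
    | some ⟨j', b⟩, hb, hbi =>
      obtain ⟨rfl, hb⟩ := hb
      exact ⟨⟨b, hb, hbi⟩, rfl⟩

theorem coefficient_node {K : Type*} [Field K] [Fintype I] [∀ p, Fintype (E p)]
    (μ : ∀ p, E p → I → K) :
    coefficient part μ (node p k lab child) =
      (∏ e : E p, ∏ i : I, fallingPow (μ p e i)
        (Nat.card {j : Fin k // lab j = e ∧ part (dec (child j) (root (child j))) = i})) *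
      ∏ j, coefficient part μ (child j) := by
  have : coefficient part μ (node p k lab child) =
    ∏ a : Option (Σ j : Fin k, Vert (child j)),
      ∏ e : E (dec (node p k lab child) a), ∏ i : I,
        fallingPow (μ (dec (node p k lab child) a) e i)
          (outdeg part (node p k lab child) a e i) := rfl
  rw [this, Fintype.prod_option, Fintype.prod_sigma]
  congr 1
  · refine Finset.prod_congr rfl fun e _ => Finset.prod_congr rfl fun i _ => ?_
    exact congrArg (fallingPow (μ p e i)) (outdeg_node_none part lab child e i)
  · refine Finset.prod_congr rfl fun j _ => Finset.prod_congr rfl fun a _ =>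
      Finset.prod_congr rfl fun e _ => Finset.prod_congr rfl fun i _ => ?_
    exact congrArg (fallingPow (μ (dec (child j) a) e i))
      (outdeg_node_some part lab child j a e i)

end Outdeg

end OrdTree
end Combinatorics

/-! ### Unique decomposition of trees by grafting, and the invariants of a grafted tree -/

section Grafting

variable {P : Type u} {E : P → Type v}

/-- The disjoint union of a family of forests, each tree carrying the index of its forest. -/
def labelledUnion {p : P} [Fintype (E p)] (F : E p → Forest P E) : Multiset (E p × Tree P E) :=
  ∑ e : E p, (F e).map fun t => (e, t)

open scoped Classical in
/-- The number of permutations of the components of a forest that fix their isomorphism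
classes. -/
noncomputable def symFactor (F : Forest P E) : ℕ := ∏ s ∈ F.toFinset, (F.count s).factorial

open scoped Classical in
theorem symFactor_eq_prod {F : Forest P E} {S : Finset (Tree P E)} (h : ∀ s ∈ F, s ∈ S) :
    symFactor F = ∏ s ∈ S, (F.count s).factorial := by
  refine Finset.prod_subset (fun s hs => h s (Multiset.mem_toFinset.1 hs)) fun s _ hs => ?_
  rw [Multiset.count_eq_zero_of_notMem (by simpa using hs), Nat.factorial_zero]

theorem symFactor_ne_zero (F : Forest P E) : symFactor F ≠ 0 :=
  Finset.prod_ne_zero_iff.2 fun _ _ => Nat.factorial_ne_zero _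

section Family
variable {p : P} [Fintype (E p)]

open scoped Classical in
theorem count_labelledUnion (F : E p → Forest P E) (e : E p) (s : Tree P E) :
    (labelledUnion F).count (e, s) = (F e).count s := by
  rw [labelledUnion, Multiset.count_sum', Finset.sum_eq_single e]
  · exact Multiset.count_map_eq_count' _ _ (fun a b h => (Prod.mk.inj h).2) _
  · intro e' _ he
    refine Multiset.count_eq_zero_of_notMem fun h => ?_
    obtain ⟨t, _, ht⟩ := Multiset.mem_map.1 h
    exact he (Prod.mk.inj ht).1
  · simp

theorem mem_labelledUnion {F : E p → Forest P E} {x : E p × Tree P E} :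
    x ∈ labelledUnion F ↔ x.2 ∈ F x.1 := by
  classical
  rw [← Multiset.count_pos, count_labelledUnion F x.1 x.2, Multiset.count_pos]

theorem labelledUnion_injective :
    Function.Injective (labelledUnion : (E p → Forest P E) → _) := by
  classical
  intro F G h
  funext e
  ext s
  rw [← count_labelledUnion, h, count_labelledUnion]

theorem labelledUnion_surjective :
    Function.Surjective (labelledUnion : (E p → Forest P E) → _) := by
  classical
  intro M
  refine ⟨fun e => (M.filter fun x => x.1 = e).map Prod.snd, ?_⟩
  ext ⟨e, s⟩
  rw [count_labelledUnion, Multiset.count_map, Multiset.filter_filter, Multiset.count,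
    Multiset.countP_eq_card_filter]
  congr 1
  refine Multiset.filter_congr fun x _ => ?_
  rw [Prod.ext_iff]
  exact ⟨fun h => ⟨h.2.symm, h.1⟩, fun h => ⟨h.2, h.1.symm⟩⟩

theorem prod_map_labelledUnion {R : Type*} [CommMonoid R] (F : E p → Forest P E)
    (h : Tree P E → R) :
    ((labelledUnion F).map fun x => h x.2).prod = ∏ e, ((F e).map h).prod := by
  rw [labelledUnion]
  simp only [← Multiset.mapAddMonoidHom_apply, map_sum, Multiset.prod_sum]
  simp [Multiset.map_map]

theorem sum_map_labelledUnion {R : Type*} [AddCommMonoid R] (F : E p → Forest P E)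
    (h : Tree P E → R) :
    ((labelledUnion F).map fun x => h x.2).sum = ∑ e, ((F e).map h).sum :=
  -- Products in `Multiplicative R` are by definition sums in `R`.
  prod_map_labelledUnion (R := Multiplicative R) F h

/-- Hides the list and the representatives chosen in `graft`; later arguments see only the multiset
of branches. -/
theorem exists_node_eq_graft (F : E p → Forest P E) :
    ∃ (k : ℕ) (lab : Fin k → E p) (child : Fin k → OrdTree P E),
      graft p F = Quotient.mk _ (OrdTree.node p k lab child) ∧
      Finset.univ.val.map (OrdTree.branches lab child) = labelledUnion F := by
  refine ⟨_, _, _, rfl, ?_⟩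
  have : ∀ L : List (E p × Tree P E),
      OrdTree.branches (fun j => (L.get j).1) (fun j => (L.get j).2.out) = L.get := by
    intro L
    funext j
    exact Prod.ext rfl (Quotient.out_eq _)
  rw [this, Fin.univ_val_map, List.ofFn_get]
  exact Multiset.coe_toList _

theorem mk_node_eq_graft {k : ℕ} {lab : Fin k → E p} {child : Fin k → OrdTree P E}
    {F : E p → Forest P E}
    (h : Finset.univ.val.map (OrdTree.branches lab child) = labelledUnion F) :
    (Quotient.mk _ (OrdTree.node p k lab child) : Tree P E) = graft p F := by
  obtain ⟨k', lab', child', h1, h2⟩ := exists_node_eq_graft F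
  rw [h1, OrdTree.node_equiv_iff, h, h2]

theorem weight_graft (wt : P → ℕ) (F : E p → Forest P E) :
    (graft p F).weight wt = wt p + ∑ e, ((F e).map (Tree.weight wt)).sum := by
  obtain ⟨k, lab, child, h1, h2⟩ := exists_node_eq_graft F
  rw [h1, ← sum_map_labelledUnion, ← h2, Multiset.map_map]
  exact OrdTree.weight_node wt lab child

/-- Branches carry their edge label, so the permutations counted in `autCard_node` act on each `F e`
separately. -/
theorem autCard_graft (F : E p → Forest P E) :
    (graft p F).autCard = (∏ e, symFactor (F e)) * ∏ e, ((F e).map Tree.autCard).prod := by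
  classical
  obtain ⟨k, lab, child, h1, h2⟩ := exists_node_eq_graft F
  rw [h1, ← prod_map_labelledUnion, ← h2, Multiset.map_map]
  refine (OrdTree.autCard_node lab child).trans ?_
  congr 1
  simp only [symFactor]
  -- The distinct branches are the pairs `(e, s)` with `s` a component of `F e`.
  rw [← Finset.prod_finset_product' (Finset.univ.image (OrdTree.branches lab child)) Finset.univ
    (fun e => (F e).toFinset) (f := fun e s => ((F e).count s).factorial)]
  · refine Finset.prod_congr rfl fun x _ => ?_
    rw [← count_labelledUnion, ← h2, Multiset.count_map, Fintype.card_subtype]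
    simp only [eq_comm (a := x)]
    rfl
  · intro x
    rw [Multiset.mem_toFinset, ← mem_labelledUnion, ← h2]
    simp

end Family

variable [∀ p, Fintype (E p)]

theorem coefficient_graft {K : Type*} [Field K] {I : Type w} [Fintype I] [DecidableEq I]
    (part : P → I) (μ : ∀ p, E p → I → K) {p : P} (F : E p → Forest P E) :
    (graft p F).coefficient part μ =
      (∏ e, ∏ i, fallingPow (μ p e i) ((F e).countP fun t => part t.rootDec = i)) *
      ∏ e, ((F e).map (Tree.coefficient part μ)).prod := by
  classical
  obtain ⟨k, lab, child, h1, h2⟩ := exists_node_eq_graft F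
  rw [h1, ← prod_map_labelledUnion, ← h2, Multiset.map_map]
  refine (OrdTree.coefficient_node part lab child μ).trans ?_
  congr 1
  refine Finset.prod_congr rfl fun e _ => Finset.prod_congr rfl fun i _ => ?_
  congr 1
  have h3 : (F e).countP (fun t => part t.rootDec = i) =
      (labelledUnion F).countP fun x => x.1 = e ∧ part x.2.rootDec = i := by
    rw [labelledUnion, ← Multiset.coe_countPAddMonoidHom, ← Multiset.coe_countPAddMonoidHom,
      map_sum, Finset.sum_eq_single e]
    · simp [Multiset.countP_eq_card_filter, Multiset.filter_map]
    · intro e' _ he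
      simp [Multiset.countP_map, he]
    · simp
  rw [h3, ← h2, Multiset.countP_map, Nat.card_eq_fintype_card, Fintype.card_subtype]
  rfl

theorem graft_injective {p q : P} {F : E p → Forest P E} {G : E q → Forest P E}
    (h : graft p F = graft q G) :
    (⟨p, F⟩ : Σ p, E p → Forest P E) = ⟨q, G⟩ := by
  obtain rfl : p = q := congrArg Tree.rootDec h
  obtain ⟨k, lab, child, h1, h2⟩ := exists_node_eq_graft F
  obtain ⟨k', lab', child', h1', h2'⟩ := exists_node_eq_graft G
  rw [h1, h1', OrdTree.node_equiv_iff, h2, h2'] at h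
  rw [labelledUnion_injective h]

theorem exists_eq_graft (t : Tree P E) : ∃ F : E t.rootDec → Forest P E, t = graft t.rootDec F := by
  induction t using Quotient.inductionOn with
  | h t =>
    cases t with
    | node p k lab child =>
      obtain ⟨F, hF⟩ := labelledUnion_surjective
        (Finset.univ.val.map (OrdTree.branches lab child))
      exact ⟨F, mk_node_eq_graft hF.symm⟩

end Grafting

/-! ### Finitely many trees and forests of each weight -/

section Finiteness

variable {P : Type u} {E : P → Type v} (wt : P → ℕ)

/-- The total weight of a forest. -/
noncomputable def forestWeight (F : Forest P E) : ℕ := (F.map (Tree.weight wt)).sum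

theorem forestWeight_add (F G : Forest P E) :
    forestWeight wt (F + G) = forestWeight wt F + forestWeight wt G := by
  simp [forestWeight]

theorem weight_le_forestWeight {F : Forest P E} {t : Tree P E} (h : t ∈ F) :
    t.weight wt ≤ forestWeight wt F :=
  Multiset.single_le_sum (fun _ _ => Nat.zero_le _) _ (Multiset.mem_map_of_mem _ h)

variable {wt}

theorem weight_pos (hwt : ∀ p, 1 ≤ wt p) (t : Tree P E) : 1 ≤ t.weight wt := by
  induction t using Quotient.inductionOn with
  | h t =>
    cases t with
    | node p k lab child =>
      refine le_trans (le_trans (hwt p) (Nat.le_add_right _ _))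
        (OrdTree.weight_node wt lab child).ge

theorem card_le_forestWeight (hwt : ∀ p, 1 ≤ wt p) (F : Forest P E) : F.card ≤ forestWeight wt F := by
  have := Multiset.card_nsmul_le_sum (s := F.map (Tree.weight wt)) (a := 1) fun x hx => by
    obtain ⟨t, _, rfl⟩ := Multiset.mem_map.1 hx
    exact weight_pos hwt t
  simpa [forestWeight] using this

/-- Weights are positive, so such a forest has at most `n` components and is a submultiset of `n`
copies of the finite set of trees of weight at most `n`. -/
theorem finite_forests_of_finite_trees (hwt : ∀ p, 1 ≤ wt p) {n : ℕ}
    (h : {t : Tree P E | t.weight wt ≤ n}.Finite) :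
    {F : Forest P E | forestWeight wt F ≤ n}.Finite := by
  classical
  refine (Set.finite_Iic (n • h.toFinset.val)).subset fun F hF => ?_
  rw [Set.mem_Iic, Multiset.le_iff_count]
  intro t
  by_cases ht : t ∈ F
  · rw [Multiset.count_nsmul, Multiset.count_eq_one_of_mem h.toFinset.nodup, mul_one]
    · exact (Multiset.count_le_card _ _).trans ((card_le_forestWeight hwt F).trans hF)
    · exact h.mem_toFinset.2 ((weight_le_forestWeight wt ht).trans hF)
  · rw [Multiset.count_eq_zero_of_notMem ht]
    exact Nat.zero_le _

variable [∀ p, Fintype (E p)]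

theorem finite_decorations_le (hfin : ∀ n, {p : P | wt p = n}.Finite) (n : ℕ) : {p : P | wt p ≤ n}.Finite := by
  have : {p : P | wt p ≤ n} = ⋃ m ∈ Set.Iic n, {p : P | wt p = m} := by ext; simp
  rw [this]
  exact (Set.finite_Iic n).biUnion fun m _ => hfin m

/-- Induction on `n`: removing a root, of weight at least `1`, leaves finitely many possible forests
at each of finitely many insertion places. -/
theorem finite_trees_le (hwt : ∀ p, 1 ≤ wt p)
    (hfin : ∀ n, {p : P | wt p = n}.Finite) (n : ℕ) : {t : Tree P E | t.weight wt ≤ n}.Finite := by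
  induction n with
  | zero =>
    refine Set.finite_empty.subset fun t ht => ?_
    have := weight_pos hwt t
    rw [Set.mem_ofPred_eq] at ht
    omega
  | succ n ih =>
    have hF := finite_forests_of_finite_trees hwt ih
    refine ((finite_decorations_le hfin (n + 1)).biUnion fun p _ =>
      (Set.Finite.pi' fun _ : E p => hF).image (graft p)).subset fun t ht => ?_
    obtain ⟨F, hF⟩ := exists_eq_graft t
    have hw := weight_graft wt F
    rw [← hF] at hw
    have hp := hwt t.rootDec
    rw [Set.mem_ofPred_eq] at ht
    simp only [Set.mem_iUnion]
    refine ⟨t.rootDec, by rw [Set.mem_ofPred_eq]; omega, F, fun e => ?_, hF.symm⟩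
    have : forestWeight wt (F e) ≤ ∑ e, forestWeight wt (F e) :=
      Finset.single_le_sum (f := fun e => forestWeight wt (F e)) (fun _ _ => Nat.zero_le _)
        (Finset.mem_univ e)
    simp only [forestWeight, Set.mem_ofPred_eq] at this ⊢
    omega

theorem finite_trees (hwt : ∀ p, 1 ≤ wt p)
    (hfin : ∀ n, {p : P | wt p = n}.Finite) (n : ℕ) : {t : Tree P E | t.weight wt = n}.Finite :=
  (finite_trees_le hwt hfin n).subset fun _ h => le_of_eq h

theorem finite_forests (hwt : ∀ p, 1 ≤ wt p)
    (hfin : ∀ n, {p : P | wt p = n}.Finite) (n : ℕ) : {F : Forest P E | forestWeight wt F = n}.Finite :=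
  (finite_forests_of_finite_trees hwt (finite_trees_le hwt hfin n)).subset fun _ h => le_of_eq h

end Finiteness

/-! ### Coefficients up to order `n` determine the `n`-th coefficient of every operation used -/

section Series

section Congr

variable {K : Type*} [Field K] {A : Type*} [CommRing A] [Algebra K A]

theorem coeff_pow_congr {S T : PowerSeries A} {n : ℕ}
    (h : ∀ m ≤ n, PowerSeries.coeff m S = PowerSeries.coeff m T) (k : ℕ) :
    PowerSeries.coeff n (S ^ k) = PowerSeries.coeff n (T ^ k) := by
  rw [PowerSeries.coeff_pow, PowerSeries.coeff_pow]
  refine Finset.sum_congr rfl fun l hl => Finset.prod_congr rfl fun i hi => h _ ?_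
  rw [← (Finset.mem_finsuppAntidiag.1 hl).1]
  exact Finset.single_le_sum (f := fun i => l i) (fun _ _ => Nat.zero_le _) hi

theorem coeff_seriesPow_congr {S T : PowerSeries A} {n : ℕ}
    (h : ∀ m ≤ n, PowerSeries.coeff m S = PowerSeries.coeff m T) (a : K) :
    PowerSeries.coeff n (seriesPow S a) = PowerSeries.coeff n (seriesPow T a) := by
  rw [seriesPow, seriesPow, PowerSeries.coeff_mk, PowerSeries.coeff_mk]
  refine Finset.sum_congr rfl fun k _ => ?_
  rw [coeff_pow_congr fun m hm => ?_]
  rw [map_sub, map_sub, h m hm]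

theorem coeff_vectorPow_congr {I : Type*} [Fintype I] {S T : I → PowerSeries A} {n : ℕ}
    (h : ∀ m ≤ n, ∀ i, PowerSeries.coeff m (S i) = PowerSeries.coeff m (T i)) (a : I → K) :
    PowerSeries.coeff n (vectorPow S a) = PowerSeries.coeff n (vectorPow T a) := by
  classical
  rw [vectorPow, vectorPow, PowerSeries.coeff_prod, PowerSeries.coeff_prod]
  refine Finset.sum_congr rfl fun l hl => Finset.prod_congr rfl fun i hi =>
    coeff_seriesPow_congr (fun m hm => h m (hm.trans ?_) i) _
  rw [← (Finset.mem_finsuppAntidiag.1 hl).1]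
  exact Finset.single_le_sum (f := fun i => l i) (fun _ _ => Nat.zero_le _) hi

theorem tensorCoeff_congr {J : Type*} [Fintype J] {S T : J → PowerSeries A} {n : ℕ}
    (h : ∀ m ≤ n, ∀ j, PowerSeries.coeff m (S j) = PowerSeries.coeff m (T j)) :
    tensorCoeff (K := K) S n = tensorCoeff T n := by
  classical
  refine Finset.sum_congr rfl fun l hl => congrArg _ (funext fun j => h _ ?_ j)
  rw [← (Finset.mem_piAntidiag.1 hl).1]
  exact Finset.single_le_sum (f := fun i => l i) (fun _ _ => Nat.zero_le _) (Finset.mem_univ j)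

end Congr

/-! ### Uniqueness of the solution -/

section Uniqueness

variable {K : Type*} [Field K] {I : Type w} [Fintype I] {P : Type u} {E : P → Type v}
  [∀ p, Fintype (E p)]

theorem coeff_insertionSeries_congr (μ : ∀ p, E p → I → K)
    {S T : I → PowerSeries (TreeAlgebra K P E)} {n : ℕ}
    (h : ∀ m ≤ n, ∀ i, PowerSeries.coeff m (S i) = PowerSeries.coeff m (T i)) (p : P) :
    PowerSeries.coeff n (insertionSeries μ S p) = PowerSeries.coeff n (insertionSeries μ T p) := by
  rw [insertionSeries, insertionSeries, PowerSeries.coeff_mk, PowerSeries.coeff_mk]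
  exact congrArg _ (tensorCoeff_congr fun m hm e =>
    coeff_vectorPow_congr (fun l hl => h l (hl.trans hm)) _)

theorem IsSolution.unique {part : P → I} {wt : P → ℕ} (hwt : ∀ p, 1 ≤ wt p)
    {μ : ∀ p, E p → I → K} {S T : I → PowerSeries (TreeAlgebra K P E)}
    (hS : IsSolution part wt μ S) (hT : IsSolution part wt μ T) : S = T := by
  suffices h : ∀ n i, PowerSeries.coeff n (S i) = PowerSeries.coeff n (T i) from
    funext fun i => PowerSeries.ext fun n => h n i
  intro n
  induction n using Nat.strong_induction_on with
  | _ n ih =>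
    intro i
    rw [hS i, hT i, map_add, map_add, PowerSeries.coeff_mk, PowerSeries.coeff_mk]
    -- The sums are compared term by term, so their finiteness plays no role here.
    refine congrArg _ (finsum_congr fun p => finsum_congr fun _ => ?_)
    rw [PowerSeries.coeff_X_pow_mul', PowerSeries.coeff_X_pow_mul']
    split_ifs with hp
    · have := hwt p
      exact coeff_insertionSeries_congr μ (fun m hm => ih m (by omega)) p
    · rfl

end Uniqueness

/-! ### Expansion of powers of tree series over forests -/

section Expansion

variable {K : Type*} [Field K] {P : Type u} {E : P → Type v} {wt : P → ℕ}

theorem prod_map_monomial_single (c : Tree P E → K) (F : Forest P E) :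
    (F.map fun t => PowerSeries.monomial (t.weight wt)
      (AddMonoidAlgebra.single ({t} : Forest P E) (c t))).prod =
    PowerSeries.monomial (forestWeight wt F) (AddMonoidAlgebra.single F (F.map c).prod) := by
  induction F using Multiset.induction with
  | empty => simp [forestWeight, ← AddMonoidAlgebra.one_def]
  | cons t F ih =>
    rw [Multiset.map_cons, Multiset.prod_cons, ih, PowerSeries.monomial_mul_monomial,
      AddMonoidAlgebra.single_mul_single, Multiset.map_cons, Multiset.prod_cons,
      Multiset.singleton_add]
    simp [forestWeight]

theorem prod_single {I : Type*} [Fintype I] (G : I → Forest P E) (g : I → K) :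
    ∏ i, AddMonoidAlgebra.single (G i) (g i) =
      AddMonoidAlgebra.single (∑ i, G i) (∏ i, g i) := by
  classical
  induction (Finset.univ : Finset I) using Finset.induction with
  | empty => exact AddMonoidAlgebra.one_def
  | insert i s hi ih =>
    rw [Finset.prod_insert hi, Finset.prod_insert hi, Finset.sum_insert hi, ih,
      AddMonoidAlgebra.single_mul_single]

/-- `countPerms` is the multinomial coefficient of the multiplicities in `F`. -/
theorem countPerms_mul_symFactor [DecidableEq (Tree P E)] (F : Forest P E) :
    F.countPerms * symFactor F = F.card.factorial := by
  have h := Nat.multinomial_spec F.toFinsupp.support F.toFinsupp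
  rw [mul_comm, symFactor_eq_prod (S := F.toFinsupp.support) fun s hs => by simpa using hs]
  have h2 : ∑ i ∈ F.toFinsupp.support, F.toFinsupp i = F.card := by
    simp
  rw [h2] at h
  rw [← h]
  congr 1
  refine Finset.prod_congr rfl fun s _ => ?_
  rw [Multiset.toFinsupp_apply]
  congr!

variable [CharZero K]

-- This is the multinomial theorem. The finsets `Ts n` and `Fs n` list the trees and forests of
-- weight `n`; `q` selects the trees that occur in `S`.
open scoped Classical in
theorem coeff_pow_eq_sum_forests {Ts : ℕ → Finset (Tree P E)} {Fs : ℕ → Finset (Forest P E)}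
    (hTs : ∀ n t, t ∈ Ts n ↔ t.weight wt = n) (hFs : ∀ n F, F ∈ Fs n ↔ forestWeight wt F = n)
    (q : Tree P E → Prop) (c : Tree P E → K) {S : PowerSeries (TreeAlgebra K P E)}
    (hS : ∀ n, PowerSeries.coeff n S =
      ∑ t ∈ Ts n with q t, AddMonoidAlgebra.single ({t} : Forest P E) (c t)) (n k : ℕ) :
    PowerSeries.coeff n (S ^ k) = ∑ F ∈ Fs n with (∀ t ∈ F, q t) ∧ F.card = k,
      AddMonoidAlgebra.single F ((k.factorial : K) * ((F.map c).prod / symFactor F)) := by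
  -- Trees of weight above `n` do not affect this coefficient, so `S` may be replaced by a finite
  -- sum.
  set U : Finset (Tree P E) := ((Finset.range (n + 1)).biUnion Ts).filter q with hU
  have memU : ∀ t, t ∈ U ↔ t.weight wt ≤ n ∧ q t := by
    intro t
    simp [hU, hTs]
  have h1 : ∀ m ≤ n, PowerSeries.coeff m S = PowerSeries.coeff m
      (∑ t ∈ U, PowerSeries.monomial (t.weight wt)
        (AddMonoidAlgebra.single ({t} : Forest P E) (c t))) := by
    intro m hm
    rw [hS, map_sum]
    simp only [PowerSeries.coeff_monomial]
    rw [← Finset.sum_filter]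
    refine Finset.sum_congr (Finset.ext fun t => ?_) fun _ _ => rfl
    rw [Finset.mem_filter, Finset.mem_filter, memU, hTs]
    constructor
    · rintro ⟨rfl, h⟩
      exact ⟨⟨hm, h⟩, rfl⟩
    · rintro ⟨⟨-, h⟩, rfl⟩
      exact ⟨rfl, h⟩
  rw [coeff_pow_congr h1, Finset.sum_pow, map_sum]
  simp only [prod_map_monomial_single, ← nsmul_eq_mul, map_nsmul, PowerSeries.coeff_monomial,
    smul_ite, smul_zero]
  rw [← Finset.sum_filter]
  refine Finset.sum_bij' (fun m _ => m.1)
    (fun F hF => ⟨F, (Finset.mem_filter.1 hF).2.2⟩) ?_ ?_ ?_ ?_ ?_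
  · intro m hm
    rw [Finset.mem_filter, Finset.mem_sym_iff] at hm
    rw [Finset.mem_filter, hFs]
    exact ⟨hm.2.symm, fun t ht => ((memU t).1 (hm.1 t ht)).2, m.2⟩
  · intro F hF
    rw [Finset.mem_filter, hFs] at hF
    refine Finset.mem_filter.2
      ⟨Finset.mem_sym_iff.2 fun t ht => (memU t).2 ⟨?_, hF.2.1 t ht⟩, hF.1.symm⟩
    rw [← hF.1]
    exact weight_le_forestWeight wt ht
  · intro m _; rfl
  · intro F _; rfl
  · intro m hm
    have hk : (k.factorial : K) = (m.1.countPerms : K) * symFactor m.1 := by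
      rw [← Nat.cast_mul, countPerms_mul_symFactor, m.2]
    have h0 : (symFactor m.1 : K) ≠ 0 := Nat.cast_ne_zero.2 (symFactor_ne_zero _)
    rw [AddMonoidAlgebra.smul_single, nsmul_eq_mul, nsmul_eq_mul, hk]
    congr 1
    field_simp

-- The `k!` in the binomial coefficient cancels the `k!` from the multinomial theorem, leaving the
-- falling power.
open scoped Classical in
theorem coeff_seriesPow_eq_sum_forests (hwt : ∀ p, 1 ≤ wt p)
    {Ts : ℕ → Finset (Tree P E)} {Fs : ℕ → Finset (Forest P E)}
    (hTs : ∀ n t, t ∈ Ts n ↔ t.weight wt = n) (hFs : ∀ n F, F ∈ Fs n ↔ forestWeight wt F = n)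
    (q : Tree P E → Prop) (c : Tree P E → K) {S : PowerSeries (TreeAlgebra K P E)}
    (hS : ∀ n, PowerSeries.coeff n (S - 1) =
      ∑ t ∈ Ts n with q t, AddMonoidAlgebra.single ({t} : Forest P E) (c t)) (a : K) (n : ℕ) :
    PowerSeries.coeff n (seriesPow S a) = ∑ F ∈ Fs n with ∀ t ∈ F, q t,
      AddMonoidAlgebra.single F (fallingPow a F.card * ((F.map c).prod / symFactor F)) := by
  rw [seriesPow, PowerSeries.coeff_mk]
  simp only [coeff_pow_eq_sum_forests hTs hFs q c hS]
  -- Group forests by number of components; this is at most the weight `n`, so the truncated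
  -- binomial series misses none.
  rw [← Finset.sum_fiberwise_of_maps_to (g := Multiset.card) (t := Finset.range (n + 1))]
  · refine Finset.sum_congr rfl fun k _ => ?_
    rw [Finset.smul_sum, Finset.filter_filter]
    refine Finset.sum_congr rfl fun F hF => ?_
    obtain ⟨-, -, rfl⟩ := Finset.mem_filter.1 hF
    have h0 : (F.card.factorial : K) ≠ 0 := Nat.cast_ne_zero.2 (Nat.factorial_ne_zero _)
    rw [AddMonoidAlgebra.smul_single, smul_eq_mul, ← mul_assoc, div_mul_cancel₀ _ h0]
  · intro F hF
    rw [Finset.mem_filter, hFs] at hF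
    rw [Finset.mem_range, Nat.lt_succ_iff, ← hF.1]
    exact card_le_forestWeight hwt F

/-! ### Vector powers: splitting a forest by the classes of its roots -/

section Components
variable {I : Type w} [DecidableEq I] (part : P → I)

/-- The components of a forest whose root has its decoration in `P_i`. -/
def component (F : Forest P E) (i : I) : Forest P E := F.filter fun t => part t.rootDec = i

theorem component_eq_self {F : Forest P E} {i : I} (h : ∀ t ∈ F, part t.rootDec = i) :
    component part F i = F := Multiset.filter_eq_self.2 h

theorem component_eq_zero {F : Forest P E} {i j : I} (h : ∀ t ∈ F, part t.rootDec = i)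
    (hij : i ≠ j) : component part F j = 0 :=
  Multiset.filter_eq_nil.2 fun t ht hj => hij ((h t ht).symm.trans hj)

variable [Fintype I]

theorem component_sum {G : I → Forest P E} (h : ∀ i, ∀ t ∈ G i, part t.rootDec = i) (i : I) :
    component part (∑ j, G j) i = G i := by
  have : component part (∑ j, G j) i = ∑ j, component part (G j) i :=
    map_sum (⟨⟨fun F => component part F i, rfl⟩, Multiset.filter_add _⟩ :
      Forest P E →+ Forest P E) _ _
  rw [this, Finset.sum_eq_single i, component_eq_self part (h i)]
  · exact fun j _ hj => component_eq_zero part (h j) hj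
  · simp

theorem sum_component (F : Forest P E) : ∑ i, component part F i = F := by
  induction F using Multiset.induction with
  | empty => simp [component]
  | cons t F ih =>
    have : ∀ i, component part (t ::ₘ F) i =
        (if part t.rootDec = i then {t} else 0) + component part F i := by
      intro i
      simp only [component, Multiset.filter_cons]
    simp only [this, Finset.sum_add_distrib, ih]
    simp

theorem prod_symFactor_component (F : Forest P E) :
    ∏ i, symFactor (component part F i) = symFactor F := by
  classical
  rw [symFactor, ← Finset.prod_fiberwise F.toFinset fun t => part t.rootDec]
  refine Finset.prod_congr rfl fun i _ => ?_
  rw [symFactor, component, Multiset.toFinset_filter]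
  refine Finset.prod_congr rfl fun t ht => ?_
  exact congrArg _ (Multiset.count_filter_of_pos (Finset.mem_filter.1 ht).2)

/-- The coefficient of the forest `F` in `𝐓 ^ m`, if `T_i - 1` is the linear combination of the
trees with root decoration in `P_i` with the coefficients `c`. -/
noncomputable def forestCoeff (c : Tree P E → K) (m : I → K) (F : Forest P E) : K :=
  (∏ i, fallingPow (m i) (F.countP fun t => part t.rootDec = i)) *
    ((F.map c).prod / symFactor F)

/-- Multiplying out, a choice of one forest of class `i` for each `i` amounts to a single forest,
their union. Equal trees lie in the same class, so the symmetry factors multiply. -/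
theorem coeff_vectorPow_eq_sum_forests (hwt : ∀ p, 1 ≤ wt p)
    {Ts : ℕ → Finset (Tree P E)} {Fs : ℕ → Finset (Forest P E)}
    (hTs : ∀ n t, t ∈ Ts n ↔ t.weight wt = n) (hFs : ∀ n F, F ∈ Fs n ↔ forestWeight wt F = n)
    (c : Tree P E → K) {T : I → PowerSeries (TreeAlgebra K P E)}
    (hT : ∀ i n, PowerSeries.coeff n (T i - 1) = ∑ t ∈ Ts n with part t.rootDec = i,
      AddMonoidAlgebra.single ({t} : Forest P E) (c t)) (m : I → K) (n : ℕ) :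
    PowerSeries.coeff n (vectorPow T m) =
      ∑ F ∈ Fs n, AddMonoidAlgebra.single F (forestCoeff part c m F) := by
  classical
  rw [vectorPow, PowerSeries.coeff_prod]
  have h1 : ∀ i n, PowerSeries.coeff n (seriesPow (T i) (m i)) =
      ∑ F ∈ Fs n with ∀ t ∈ F, part t.rootDec = i,
        AddMonoidAlgebra.single F (fallingPow (m i) F.card * ((F.map c).prod / symFactor F)) := by
    intro i n
    convert coeff_seriesPow_eq_sum_forests hwt hTs hFs (fun t => part t.rootDec = i) c
      (S := T i) ?_ (m i) n
    intro n
    convert hT i n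
  simp only [h1, Finset.prod_univ_sum, prod_single]
  rw [Finset.sum_sigma']
  have hw : ∀ G : I → Forest P E, forestWeight wt (∑ i, G i) = ∑ i, forestWeight wt (G i) :=
    fun G => map_sum (⟨⟨forestWeight wt, rfl⟩, forestWeight_add wt⟩ : Forest P E →+ ℕ) _ _
  refine Finset.sum_bij' (fun x _ => ∑ i, x.2 i)
    -- The exponents in the product of series are forced to be the weights of the class components.
    (fun F _ => ⟨Finsupp.equivFunOnFinite.symm fun i => forestWeight wt (component part F i),
      component part F⟩) ?_ ?_ ?_ ?_ ?_
  · rintro ⟨l, G⟩ hx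
    simp only [Finset.mem_sigma, Finset.mem_finsuppAntidiag, Fintype.mem_piFinset,
      Finset.mem_filter, hFs] at hx
    simp only [hFs, hw, fun i => (hx.2 i).1]
    exact hx.1.1
  · intro F hF
    simp only [Finset.mem_sigma, Finset.mem_finsuppAntidiag, Fintype.mem_piFinset,
      Finset.mem_filter, hFs] at hF ⊢
    refine ⟨⟨?_, Finset.subset_univ _⟩, fun i => ⟨rfl, fun t ht => (Multiset.mem_filter.1 ht).2⟩⟩
    simp only [Finsupp.equivFunOnFinite_symm_apply_apply]
    rw [← hw, sum_component, hF]
  · rintro ⟨l, G⟩ hx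
    simp only [Finset.mem_sigma, Finset.mem_finsuppAntidiag, Fintype.mem_piFinset,
      Finset.mem_filter, hFs] at hx
    have hG : component part (∑ i, G i) = G :=
      funext fun i => component_sum part (fun i => (hx.2 i).2) i
    rw [hG]
    congr 1
    ext i
    exact (hx.2 i).1
  · intro F _
    exact sum_component part F
  · rintro ⟨l, G⟩ hx
    simp only [Finset.mem_sigma, Finset.mem_finsuppAntidiag, Fintype.mem_piFinset,
      Finset.mem_filter, hFs] at hx
    have hG : ∀ i, component part (∑ i, G i) i = G i :=
      component_sum part (fun i => (hx.2 i).2)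
    simp only [forestCoeff]
    congr 1
    rw [Finset.prod_mul_distrib]
    congr 1
    · refine Finset.prod_congr rfl fun i _ => ?_
      rw [Multiset.countP_eq_card_filter]
      exact congrArg (fun F : Forest P E => fallingPow (m i) F.card) (hG i).symm
    · rw [← prod_symFactor_component part, Finset.prod_div_distrib]
      simp only [hG]
      rw [Nat.cast_prod]
      congr 1
      simp only [← Multiset.mapAddMonoidHom_apply, map_sum, Multiset.prod_sum]

end Components
end Expansion
end Series

/-! ### The tree series solves the system -/

section Existence

variable {K : Type*} [Field K] {I : Type w} [Fintype I]
  {P : Type u} {E : P → Type v} [∀ p, Fintype (E p)]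

theorem Bplus_tprod_single (p : P) (F : E p → Forest P E) :
    Bplus K p (PiTensorProduct.tprod K fun e => AddMonoidAlgebra.single (F e) (1 : K)) =
      (graft p F).toAlgebra K := by
  have h := Module.Basis.constr_basis
    (Basis.piTensorProduct fun _ : E p => AddMonoidAlgebra.basis (Forest P E) K) K
    (fun F : E p → Forest P E => (graft p F).toAlgebra K) F
  rw [Basis.piTensorProduct_apply] at h
  simp only [AddMonoidAlgebra.basis_apply] at h
  exact h

open scoped Classical in
theorem Bplus_tensorCoeff {Fs : ℕ → Finset (Forest P E)} (p : P) (g : E p → Forest P E → K)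
    {S : E p → PowerSeries (TreeAlgebra K P E)}
    (hS : ∀ e n, PowerSeries.coeff n (S e) =
      ∑ F ∈ Fs n, AddMonoidAlgebra.single F (g e F)) (n : ℕ) :
    Bplus K p (tensorCoeff S n) =
      ∑ a ∈ Finset.piAntidiag (Finset.univ : Finset (E p)) n,
        ∑ F ∈ Fintype.piFinset fun e => Fs (a e),
          (∏ e, g e (F e)) • (graft p F).toAlgebra K := by
  rw [tensorCoeff, map_sum]
  refine Finset.sum_congr rfl fun a _ => ?_
  simp only [hS]
  rw [MultilinearMap.map_sum_finset, map_sum]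
  refine Finset.sum_congr rfl fun F _ => ?_
  rw [← Bplus_tprod_single, ← map_smul, ← MultilinearMap.map_smul_univ]
  simp only [AddMonoidAlgebra.smul_single, smul_eq_mul, mul_one]

/-- The coefficient of the tree `t` in the solution of the system. -/
noncomputable def treeCoeff (part : P → I) (μ : ∀ p, E p → I → K) (t : Tree P E) : K :=
  t.coefficient part μ / t.autCard

theorem prod_map_treeCoeff (part : P → I) (μ : ∀ p, E p → I → K) (F : Forest P E) :
    (F.map (treeCoeff part μ)).prod =
      (F.map (Tree.coefficient part μ)).prod / ((F.map Tree.autCard).prod : ℕ) := by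
  induction F using Multiset.induction with
  | empty => simp
  | cons t F ih =>
    simp only [Multiset.map_cons, Multiset.prod_cons, ih, treeCoeff, Nat.cast_mul]
    rw [div_mul_div_comm]

/-- The heart of the existence proof: the recursion for `treeCoeff` matches the forest coefficients
of the vector powers. -/
theorem treeCoeff_graft [DecidableEq I] (part : P → I) (μ : ∀ p, E p → I → K) {p : P}
    (F : E p → Forest P E) :
    treeCoeff part μ (graft p F) =
      ∏ e, forestCoeff part (treeCoeff part μ) (μ p e) (F e) := by
  simp only [forestCoeff, prod_map_treeCoeff]
  rw [treeCoeff, coefficient_graft, autCard_graft, Finset.prod_mul_distrib,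
    Finset.prod_div_distrib, Finset.prod_div_distrib, mul_div_assoc]
  congr 1
  rw [div_div, Nat.cast_mul, Nat.cast_prod, Nat.cast_prod, mul_comm (∏ e, (symFactor (F e) : K))]

theorem coeff_treeSeries_sub_one [DecidableEq I] {part : P → I} {wt : P → ℕ}
    {μ : ∀ p, E p → I → K} {Ts : ℕ → Finset (Tree P E)}
    (hTs : ∀ n t, t ∈ Ts n ↔ t.weight wt = n) (i : I) (n : ℕ) :
    PowerSeries.coeff n (treeSeries part wt μ i - 1) =
      ∑ t ∈ Ts n with part t.rootDec = i,
        AddMonoidAlgebra.single ({t} : Forest P E) (treeCoeff part μ t) := by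
  rw [treeSeries, add_sub_cancel_left, PowerSeries.coeff_mk]
  -- The index set is finite, so the `finsum` is a genuine sum and not the default `0`.
  have h : {t : Tree P E | part t.rootDec = i ∧ t.weight wt = n} =
      ↑((Ts n).filter fun t => part t.rootDec = i) := by
    ext t
    simp [hTs, and_comm]
  rw [h, finsum_mem_coe_finset]
  refine Finset.sum_congr rfl fun t _ => ?_
  rw [Tree.toAlgebra, AddMonoidAlgebra.smul_single, smul_eq_mul, mul_one, treeCoeff]

variable [CharZero K]

theorem isSolution_treeSeries (part : P → I) (wt : P → ℕ) (hwt : ∀ p, 1 ≤ wt p)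
    (hfin : ∀ n, {p : P | wt p = n}.Finite) (μ : ∀ p, E p → I → K) :
    IsSolution part wt μ (treeSeries part wt μ) := by
  classical
  set Ts : ℕ → Finset (Tree P E) := fun n => (finite_trees hwt hfin n).toFinset
  set Fs : ℕ → Finset (Forest P E) := fun n => (finite_forests hwt hfin n).toFinset
  have hTs : ∀ n t, t ∈ Ts n ↔ t.weight wt = n := fun n t => Set.Finite.mem_toFinset _
  have hFs : ∀ n F, F ∈ Fs n ↔ forestWeight wt F = n := fun n F => Set.Finite.mem_toFinset _
  intro i
  rw [← sub_eq_iff_eq_add']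
  ext1 n
  rw [coeff_treeSeries_sub_one hTs, PowerSeries.coeff_mk]
  have hins : ∀ p n, PowerSeries.coeff n (insertionSeries μ (treeSeries part wt μ) p) =
      ∑ a ∈ Finset.piAntidiag (Finset.univ : Finset (E p)) n,
        ∑ F ∈ Fintype.piFinset fun e => Fs (a e),
          AddMonoidAlgebra.single ({graft p F} : Forest P E)
            (treeCoeff part μ (graft p F)) := by
    intro p n
    rw [insertionSeries, PowerSeries.coeff_mk, Bplus_tensorCoeff p _ fun e n =>
      coeff_vectorPow_eq_sum_forests part hwt hTs hFs (treeCoeff part μ)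
        (coeff_treeSeries_sub_one hTs) (μ p e) n]
    refine Finset.sum_congr rfl fun a _ => Finset.sum_congr rfl fun F _ => ?_
    rw [treeCoeff_graft, Tree.toAlgebra, AddMonoidAlgebra.smul_single, smul_eq_mul, mul_one]
  -- A decoration of weight above `n` contributes nothing to `x ^ n`.
  set Ps : Finset P := (finite_decorations_le hfin n).toFinset.filter fun p => part p = i with hPs
  have memPs : ∀ p, p ∈ Ps ↔ wt p ≤ n ∧ part p = i := by
    intro p
    simp [hPs]
  have hsum : ∑ᶠ p ∈ {p : P | part p = i}, PowerSeries.coeff n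
        ((PowerSeries.X : PowerSeries (TreeAlgebra K P E)) ^ wt p *
          insertionSeries μ (treeSeries part wt μ) p) =
      ∑ p ∈ Ps, PowerSeries.coeff (n - wt p) (insertionSeries μ (treeSeries part wt μ) p) := by
    rw [finsum_mem_eq_sum_of_inter_support_eq (t := Ps)]
    · refine Finset.sum_congr rfl fun p hp => ?_
      rw [PowerSeries.coeff_X_pow_mul', if_pos ((memPs p).1 hp).1]
    · ext p
      simp only [Set.mem_inter_iff, Set.mem_ofPred_eq, Finset.mem_coe, memPs,
        Function.mem_support, PowerSeries.coeff_X_pow_mul', ne_eq, ite_eq_right_iff,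
        not_forall]
      constructor
      · rintro ⟨h, hw, h'⟩
        exact ⟨⟨hw, h⟩, hw, h'⟩
      · rintro ⟨⟨-, h⟩, hw, h'⟩
        exact ⟨h, hw, h'⟩
  rw [hsum]
  simp only [hins]
  rw [Finset.sum_congr rfl fun p _ => Finset.sum_sigma' _ _ _, Finset.sum_sigma']
  symm
  -- The index is a triple `(p, a, F)` in which `a e` is the weight of `F e`; since `a` is
  -- determined by `F`, unique decomposition makes this a bijection onto the trees of weight `n` and
  -- class `i`.
  refine Finset.sum_nbij (fun x => graft x.1 x.2.2) ?_ ?_ ?_ fun _ _ => rfl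
  · rintro ⟨p, a, F⟩ hx
    simp only [Finset.mem_sigma, memPs, Finset.mem_piAntidiag, Fintype.mem_piFinset, hFs] at hx
    obtain ⟨⟨hp, hi⟩, ⟨ha, -⟩, hF⟩ := hx
    refine Finset.mem_filter.2 ⟨(hTs _ _).2 ((weight_graft wt F).trans ?_), hi⟩
    have : ∑ e, forestWeight wt (F e) = n - wt p := by
      rw [← ha]
      exact Finset.sum_congr rfl fun e _ => hF e
    simp only [forestWeight] at this
    omega
  · rintro ⟨p, a, F⟩ hx ⟨q, b, G⟩ hy h
    simp only [Finset.mem_coe, Finset.mem_sigma, Fintype.mem_piFinset, hFs] at hx hy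
    have h' := graft_injective h
    cases h'
    have : a = b := funext fun e => (hx.2.2 e).symm.trans (hy.2.2 e)
    rw [this]
  · intro t ht
    rw [Finset.mem_coe, Finset.mem_filter, hTs] at ht
    obtain ⟨F, hF⟩ := exists_eq_graft t
    have hw := weight_graft wt F
    rw [← hF, ht.1] at hw
    refine ⟨⟨t.rootDec, fun e => forestWeight wt (F e), F⟩, ?_, hF.symm⟩
    simp only [Finset.mem_coe, Finset.mem_sigma, memPs, Finset.mem_piAntidiag,
      Fintype.mem_piFinset, hFs]
    refine ⟨⟨by omega, ht.2⟩, ⟨?_, fun _ _ => Finset.mem_univ _⟩, fun _ => trivial⟩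
    simp only [forestWeight]
    omega

end Existence
end DSE

theorem mainTheorem4 {K : Type*} [Field K] [CharZero K] {I : Type*} [Fintype I]
    {P : Type*} {E : P → Type*} [∀ p, Fintype (E p)]
    (part : P → I) (wt : P → ℕ) (hwt : ∀ p, 1 ≤ wt p) (hfin : ∀ n, {p : P | wt p = n}.Finite)
    (μ : ∀ p, E p → I → K) :
    (∀ n, {t : DSE.Tree P E | t.weight wt = n}.Finite) ∧
    ∀ T : I → PowerSeries (DSE.TreeAlgebra K P E),
      DSE.IsSolution part wt μ T ↔ T = DSE.treeSeries part wt μ := by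
  have hsol := DSE.isSolution_treeSeries part wt hwt hfin μ
  exact ⟨DSE.finite_trees hwt hfin, fun T =>
    ⟨fun hT => hT.unique hwt hsol, fun hT => hT ▸ hsol⟩⟩
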